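/- Simple types are generated by $A,B ::= o \mid A\to B \mid A\times B \mid 1$. For a simple type $A$, let $\mathrm{Tm}(A)$ be the set of closed simply typed $\lambda$-terms of type $A$ (with abstraction, application, pairs, projections and the unit term), modulo $\beta\eta$-conversion (including surjective pairing and the $\eta$-rule for $1$). A language of $\lambda$-terms of type $A$ is a subset $L\subseteq \mathrm{Tm}(A)$. For a simple type $B$, let $A[B]$ be the type obtained from $A$ by replacing every occurrence of $o$ by $B$; for $t\in \mathrm{Tm}(A)$, let $t[B]\in \mathrm{Tm}(A[B])$ be obtained from $t$ by making this replacement in its type annotations. Let $\mathrm{Bool} := (o\times o)\to o$ and $\mathsf{true} := \lambda(x:o\times o).\,x_1$. The language $L\subseteq \mathrm{Tm}(A)$ is Hillebrand–Kanellakis-recognizable if there are a simple type $B$ and $r\in \mathrm{Tm}(A[B]\to \mathrm{Bool})$ such that $L=\{t\in \mathrm{Tm}(A) \mid r\ t[B] =_{\beta\eta} \mathsf{true}\}$. Let $\mathcal C$ be a cartesian closed category (CCC), with specified terminal object, binary products and exponentials. For an object $c$ of $\mathcal C$, let $[\![A]\!]_c$ be the object obtained by interpreting $o$ as $c$ and the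 type constructors $\to,\times,1$ by the CCC structure, and let $[\![-]\!]_c : \mathrm{Tm}(A)\to \mathcal C(1,[\![A]\!]_c)$ be the usual interpretation of closed $\lambda$-terms. A language $L\subseteq \mathrm{Tm}(A)$ is recognized at $c$ if $L=\{t\in \mathrm{Tm}(A) \mid [\![t]\!]_c\in F\}$ for some $F\subseteq \mathcal C(1,[\![A]\!]_c)$, and it is recognized by $\mathcal C$ if it is recognized at some object of $\mathcal C$. The CCC $\mathcal C$ is non-degenerate if it has two distinct parallel morphisms $f,g : c'\to c$. Theorem. If $\mathcal C$ is a non-degenerate CCC, then every Hillebrand–Kanellakis-recognizable language of $\lambda$-terms is recognized by $\mathcal C$. More precisely, let $c$ be any object of $\mathcal C$ that is the codomain of two distinct parallel morphisms, let $A$ and $B$ be simple types, and let $r\in \mathrm{Tm}(A[B]\to \mathrm{Bool})$. Then the language $\{t\in \mathrm{Tm}(A) \mid r\ t[B] =_{\beta\eta} \mathsf{true}\}$ is recognized at the object $[\![B]\!]_c$. -/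

import Mathlib

open CategoryTheory MonoidalCategory CartesianMonoidalCategory

universe v u

namespace STLC

/-- Simple types over a single base type. -/
inductive Ty : Type
  | base : Ty
  | arr : Ty → Ty → Ty
  | prod : Ty → Ty → Ty
  | unit : Ty

/-- Type substitution `A[B]`: every occurrence of the base type in `A` is replaced by `B`. -/
def castTy (B : Ty) : Ty → Ty
  | .base => B
  | .arr A₁ A₂ => .arr (castTy B A₁) (castTy B A₂)
  | .prod A₁ A₂ => .prod (castTy B A₁) (castTy B A₂)
  | .unit => .unit

/-- Contexts; the head of the list is the type of the most recently bound variable. -/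
abbrev Ctx : Type := List Ty

/-- `Var Γ A` is the type of (de Bruijn) variables of type `A` in the context `Γ`. -/
inductive Var : Ctx → Ty → Type
  | zero {Γ : Ctx} {A : Ty} : Var (A :: Γ) A
  | succ {Γ : Ctx} {A B : Ty} : Var Γ A → Var (B :: Γ) A

/-- `Term Γ A` is the type of simply typed λ-terms of type `A` in the context `Γ`, up to renaming
of bound variables. -/
inductive Term : Ctx → Ty → Type
  | var {Γ : Ctx} {A : Ty} : Var Γ A → Term Γ A
  | lam {Γ : Ctx} {A B : Ty} : Term (A :: Γ) B → Term Γ (.arr A B)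
  | app {Γ : Ctx} {A B : Ty} : Term Γ (.arr A B) → Term Γ A → Term Γ B
  | pair {Γ : Ctx} {A B : Ty} : Term Γ A → Term Γ B → Term Γ (.prod A B)
  | fst {Γ : Ctx} {A B : Ty} : Term Γ (.prod A B) → Term Γ A
  | snd {Γ : Ctx} {A B : Ty} : Term Γ (.prod A B) → Term Γ B
  | star {Γ : Ctx} : Term Γ .unit

/-- Renamings, that is, maps from the variables of `Γ` to those of `Δ`. -/
abbrev Ren (Γ Δ : Ctx) : Type := ∀ A : Ty, Var Γ A → Var Δ A

/-- Simultaneous substitutions of terms in context `Δ` for the variables of `Γ`. -/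
abbrev Sub (Γ Δ : Ctx) : Type := ∀ A : Ty, Var Γ A → Term Δ A

/-- Extension of a renaming under a binder. -/
def Ren.lift {Γ Δ : Ctx} (ρ : Ren Γ Δ) (B : Ty) : Ren (B :: Γ) (B :: Δ)
  | _, .zero => .zero
  | _, .succ x => .succ (ρ _ x)

/-- Renaming of the free variables of a term. -/
def Term.rename {Γ : Ctx} {A : Ty} (t : Term Γ A) : ∀ {Δ : Ctx}, Ren Γ Δ → Term Δ A :=
  match t with
  | .var x => fun ρ => .var (ρ _ x)
  | .lam t => fun ρ => .lam (t.rename (ρ.lift _))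
  | .app t s => fun ρ => .app (t.rename ρ) (s.rename ρ)
  | .pair t s => fun ρ => .pair (t.rename ρ) (s.rename ρ)
  | .fst t => fun ρ => .fst (t.rename ρ)
  | .snd t => fun ρ => .snd (t.rename ρ)
  | .star => fun _ => .star

/-- Weakening by one fresh variable. -/
def Term.weaken {Γ : Ctx} {A : Ty} (B : Ty) (t : Term Γ A) : Term (B :: Γ) A :=
  t.rename (fun _ x => .succ x)

/-- Extension of a substitution under a binder. -/
def Sub.lift {Γ Δ : Ctx} (σ : Sub Γ Δ) (B : Ty) : Sub (B :: Γ) (B :: Δ)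
  | _, .zero => .var .zero
  | _, .succ x => (σ _ x).weaken B

/-- Capture-avoiding simultaneous substitution. -/
def Term.subst {Γ : Ctx} {A : Ty} (t : Term Γ A) : ∀ {Δ : Ctx}, Sub Γ Δ → Term Δ A :=
  match t with
  | .var x => fun σ => σ _ x
  | .lam t => fun σ => .lam (t.subst (σ.lift _))
  | .app t s => fun σ => .app (t.subst σ) (s.subst σ)
  | .pair t s => fun σ => .pair (t.subst σ) (s.subst σ)
  | .fst t => fun σ => .fst (t.subst σ)
  | .snd t => fun σ => .snd (t.subst σ)
  | .star => fun _ => .star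

/-- The substitution of `s` for the most recently bound variable. -/
def Sub.single {Γ : Ctx} {B : Ty} (s : Term Γ B) : Sub (B :: Γ) Γ
  | _, .zero => s
  | _, .succ x => .var x

/-- Typed `βη`-conversion: the least congruence containing the `β` and `η` rules for function,
product and unit types. -/
inductive Conv : ∀ {Γ : Ctx} {A : Ty}, Term Γ A → Term Γ A → Prop
  | refl {Γ : Ctx} {A : Ty} (t : Term Γ A) : Conv t t
  | symm {Γ : Ctx} {A : Ty} {t s : Term Γ A} : Conv t s → Conv s t
  | trans {Γ : Ctx} {A : Ty} {t s r : Term Γ A} : Conv t s → Conv s r → Conv t r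
  | lam {Γ : Ctx} {A B : Ty} {t t' : Term (A :: Γ) B} : Conv t t' → Conv (.lam t) (.lam t')
  | app {Γ : Ctx} {A B : Ty} {t t' : Term Γ (.arr A B)} {s s' : Term Γ A} :
      Conv t t' → Conv s s' → Conv (.app t s) (.app t' s')
  | pair {Γ : Ctx} {A B : Ty} {t t' : Term Γ A} {s s' : Term Γ B} :
      Conv t t' → Conv s s' → Conv (.pair t s) (.pair t' s')
  | fst {Γ : Ctx} {A B : Ty} {t t' : Term Γ (.prod A B)} :
      Conv t t' → Conv (.fst t) (.fst t')
  | snd {Γ : Ctx} {A B : Ty} {t t' : Term Γ (.prod A B)} :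
      Conv t t' → Conv (.snd t) (.snd t')
  | beta {Γ : Ctx} {A B : Ty} (t : Term (A :: Γ) B) (s : Term Γ A) :
      Conv (.app (.lam t) s) (t.subst (Sub.single s))
  | beta_fst {Γ : Ctx} {A B : Ty} (t : Term Γ A) (s : Term Γ B) : Conv (.fst (.pair t s)) t
  | beta_snd {Γ : Ctx} {A B : Ty} (t : Term Γ A) (s : Term Γ B) : Conv (.snd (.pair t s)) s
  | eta {Γ : Ctx} {A B : Ty} (t : Term Γ (.arr A B)) :
      Conv (.lam (.app (t.weaken A) (.var .zero))) t
  | eta_pair {Γ : Ctx} {A B : Ty} (t : Term Γ (.prod A B)) : Conv (.pair (.fst t) (.snd t)) t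
  | eta_unit {Γ : Ctx} (t : Term Γ .unit) : Conv t .star

/-- `βη`-conversion as a setoid on the closed terms of a given type. -/
instance closedSetoid (A : Ty) : Setoid (Term [] A) where
  r := Conv
  iseqv := ⟨Conv.refl, Conv.symm, Conv.trans⟩

/-- Closed simply typed λ-terms of type `A`, modulo `βη`-conversion. -/
def Tm (A : Ty) : Type := Quotient (closedSetoid A)

/-- The class of a closed term modulo `βη`-conversion. -/
def Tm.mk {A : Ty} (t : Term [] A) : Tm A := Quotient.mk (closedSetoid A) t

/-- Application of closed terms modulo `βη`-conversion. -/
def Tm.app {A B : Ty} (t : Tm (.arr A B)) (s : Tm A) : Tm B :=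
  Quotient.liftOn₂ t s (fun t s => Tm.mk (.app t s))
    (fun _ _ _ _ h₁ h₂ => Quotient.sound (Conv.app h₁ h₂))

/-! ### Casting of terms -/

/-- The variable of the substituted context that corresponds to a given variable. -/
def Var.cast (B : Ty) : ∀ {Γ : Ctx} {A : Ty}, Var Γ A → Var (Γ.map (castTy B)) (castTy B A)
  | _, _, .zero => .zero
  | _, _, .succ x => .succ (Var.cast B x)

/-- The term `t[B]`: the base type is replaced by `B` in all type annotations of `t`. -/
def Term.cast (B : Ty) :
    ∀ {Γ : Ctx} {A : Ty}, Term Γ A → Term (Γ.map (castTy B)) (castTy B A)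
  | _, _, .var x => .var (x.cast B)
  | _, _, .lam t => .lam (Term.cast B t)
  | _, _, .app t s => .app (Term.cast B t) (Term.cast B s)
  | _, _, .pair t s => .pair (Term.cast B t) (Term.cast B s)
  | _, _, .fst t => .fst (Term.cast B t)
  | _, _, .snd t => .snd (Term.cast B t)
  | _, _, .star => .star

theorem Term.cast_rename (B : Ty) {Γ : Ctx} {A : Ty} (t : Term Γ A) :
    ∀ {Δ : Ctx} (ρ : Ren Γ Δ) (ρ' : Ren (Γ.map (castTy B)) (Δ.map (castTy B))),
      (∀ (A' : Ty) (x : Var Γ A'), ρ' _ (x.cast B) = (ρ _ x).cast B) →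
      (t.rename ρ).cast B = (t.cast B).rename ρ' := by
  induction t with
  | var x => intro Δ ρ ρ' h; simp [Term.rename, Term.cast, h]
  | lam t ih =>
    intro Δ ρ ρ' h
    simp only [Term.rename, Term.cast]
    congr 1
    refine ih (ρ.lift _) (ρ'.lift _) ?_
    intro A' x
    cases x with
    | zero => rfl
    | succ x => simp [Var.cast, Ren.lift, h]
  | app t s iht ihs =>
    intro Δ ρ ρ' h; exact congrArg₂ Term.app (iht ρ ρ' h) (ihs ρ ρ' h)
  | pair t s iht ihs =>
    intro Δ ρ ρ' h; exact congrArg₂ Term.pair (iht ρ ρ' h) (ihs ρ ρ' h)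
  | fst t ih => intro Δ ρ ρ' h; exact congrArg Term.fst (ih ρ ρ' h)
  | snd t ih => intro Δ ρ ρ' h; exact congrArg Term.snd (ih ρ ρ' h)
  | star => intro Δ ρ ρ' h; rfl

theorem Term.cast_weaken (B : Ty) {Γ : Ctx} {A : Ty} (A' : Ty) (t : Term Γ A) :
    (t.weaken A').cast B = (t.cast B).weaken (castTy B A') :=
  Term.cast_rename B t _ _ (fun _ _ => rfl)

theorem Term.cast_subst (B : Ty) {Γ : Ctx} {A : Ty} (t : Term Γ A) :
    ∀ {Δ : Ctx} (σ : Sub Γ Δ) (σ' : Sub (Γ.map (castTy B)) (Δ.map (castTy B))),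
      (∀ (A' : Ty) (x : Var Γ A'), σ' _ (x.cast B) = (σ _ x).cast B) →
      (t.subst σ).cast B = (t.cast B).subst σ' := by
  induction t with
  | var x => intro Δ σ σ' h; simp [Term.subst, Term.cast, h]
  | lam t ih =>
    intro Δ σ σ' h
    simp only [Term.subst, Term.cast]
    congr 1
    refine ih (σ.lift _) (σ'.lift _) ?_
    intro A' x
    cases x with
    | zero => rfl
    | succ x => simp [Var.cast, Sub.lift, h, Term.cast_weaken]
  | app t s iht ihs =>
    intro Δ σ σ' h; exact congrArg₂ Term.app (iht σ σ' h) (ihs σ σ' h)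
  | pair t s iht ihs =>
    intro Δ σ σ' h; exact congrArg₂ Term.pair (iht σ σ' h) (ihs σ σ' h)
  | fst t ih => intro Δ σ σ' h; exact congrArg Term.fst (ih σ σ' h)
  | snd t ih => intro Δ σ σ' h; exact congrArg Term.snd (ih σ σ' h)
  | star => intro Δ σ σ' h; rfl

theorem Conv.cast (B : Ty) {Γ : Ctx} {A : Ty} {t s : Term Γ A} (h : Conv t s) :
    Conv (t.cast B) (s.cast B) := by
  induction h with
  | refl t => exact .refl _
  | symm _ ih => exact .symm ih
  | trans _ _ ih₁ ih₂ => exact .trans ih₁ ih₂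
  | lam _ ih => exact .lam ih
  | app _ _ ih₁ ih₂ => exact .app ih₁ ih₂
  | pair _ _ ih₁ ih₂ => exact .pair ih₁ ih₂
  | fst _ ih => exact .fst ih
  | snd _ ih => exact .snd ih
  | beta t s =>
    rw [Term.cast_subst B t (Sub.single s) (Sub.single (s.cast B))]
    · exact .beta _ _
    · intro A' x
      cases x <;> rfl
  | beta_fst t s => exact .beta_fst _ _
  | beta_snd t s => exact .beta_snd _ _
  | eta t =>
    simp only [Term.cast, Term.cast_weaken]
    exact .eta _
  | eta_pair t => exact .eta_pair _
  | eta_unit t => exact .eta_unit _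

/-- The cast `t ↦ t[B]` on closed terms modulo `βη`-conversion. -/
def Tm.cast (B : Ty) {A : Ty} (t : Tm A) : Tm (castTy B A) :=
  Quotient.liftOn t (fun t => Tm.mk (Term.cast B t))
    (fun _ _ h => Quotient.sound (Conv.cast B h))

/-! ### Syntactic recognition -/

/-- The type of Booleans, `o × o → o`. -/
def boolTy : Ty := .arr (.prod .base .base) .base

/-- The Boolean `true`, that is, the first projection. -/
def tmTrue : Tm boolTy := Tm.mk (.lam (.fst (.var .zero)))

/-- The Boolean `false`, that is, the second projection. -/
def tmFalse : Tm boolTy := Tm.mk (.lam (.snd (.var .zero)))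

/-- The language of those `t` such that `r t[B]` is `βη`-convertible to `true`. -/
def hkLang {A B : Ty} (r : Tm (.arr (castTy B A) boolTy)) : Set (Tm A) :=
  {t | r.app (t.cast B) = tmTrue}

/-- Hillebrand–Kanellakis-recognizable languages of λ-terms. -/
def IsHKReg {A : Ty} (L : Set (Tm A)) : Prop :=
  ∃ (B : Ty) (r : Tm (.arr (castTy B A) boolTy)), L = hkLang r

/-! ### Semantics in cartesian closed categories -/

section Semantics

set_option linter.unusedSectionVars false

variable {C : Type u} [Category.{v} C] [CartesianMonoidalCategory C] [MonoidalClosed C]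

/-- The interpretation `⟦A⟧_c` of a simple type `A` at the object `c`. -/
def Ty.sem (c : C) : Ty → C
  | .base => c
  | .arr A B => (ihom (Ty.sem c A)).obj (Ty.sem c B)
  | .prod A B => Ty.sem c A ⊗ Ty.sem c B
  | .unit => 𝟙_ C

/-- The interpretation of a context, as the product of the interpretations of its types. -/
def Ctx.sem (c : C) : Ctx → C
  | [] => 𝟙_ C
  | A :: Γ => Ty.sem c A ⊗ Ctx.sem c Γ

/-- Variables are interpreted by projections. -/
def Var.sem (c : C) : ∀ {Γ : Ctx} {A : Ty}, Var Γ A → (Ctx.sem c Γ ⟶ Ty.sem c A)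
  | _, _, .zero => CartesianMonoidalCategory.fst _ _
  | _, _, .succ x => CartesianMonoidalCategory.snd _ _ ≫ Var.sem c x

/-- The interpretation of a λ-term in context. -/
def Term.sem (c : C) : ∀ {Γ : Ctx} {A : Ty}, Term Γ A → (Ctx.sem c Γ ⟶ Ty.sem c A)
  | _, _, .var x => Var.sem c x
  | _, _, .lam t => MonoidalClosed.curry (Term.sem c t)
  | _, _, .app t s =>
      CartesianMonoidalCategory.lift (Term.sem c s) (Term.sem c t) ≫ (ihom.ev _).app _
  | _, _, .pair t s => CartesianMonoidalCategory.lift (Term.sem c t) (Term.sem c s)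
  | _, _, .fst t => Term.sem c t ≫ CartesianMonoidalCategory.fst _ _
  | _, _, .snd t => Term.sem c t ≫ CartesianMonoidalCategory.snd _ _
  | _, _, .star => toUnit _

theorem sem_app_aux {X Y P Q : C} {m : X ⟶ Y} {f : Y ⟶ (ihom P).obj Q} {g : Y ⟶ P}
    {f' : X ⟶ (ihom P).obj Q} {g' : X ⟶ P} (hf : f' = m ≫ f) (hg : g' = m ≫ g) :
    CartesianMonoidalCategory.lift g' f' ≫ (ihom.ev P).app Q =
      m ≫ CartesianMonoidalCategory.lift g f ≫ (ihom.ev P).app Q := by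
  rw [hf, hg, comp_lift_assoc]

theorem sem_pair_aux {X Y P Q : C} {m : X ⟶ Y} {f : Y ⟶ P} {g : Y ⟶ Q}
    {f' : X ⟶ P} {g' : X ⟶ Q} (hf : f' = m ≫ f) (hg : g' = m ≫ g) :
    CartesianMonoidalCategory.lift f' g' = m ≫ CartesianMonoidalCategory.lift f g := by
  rw [hf, hg, comp_lift]

theorem sem_comp_aux {X Y P Q : C} {m : X ⟶ Y} {f : Y ⟶ P} {f' : X ⟶ P} (hf : f' = m ≫ f)
    (k : P ⟶ Q) : f' ≫ k = m ≫ f ≫ k := by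
  rw [hf, Category.assoc]

theorem sem_lam_aux {X Y P Q : C} {m : X ⟶ Y} {f : P ⊗ Y ⟶ Q} {f' : P ⊗ X ⟶ Q}
    (hf : f' = P ◁ m ≫ f) : MonoidalClosed.curry f' = m ≫ MonoidalClosed.curry f := by
  rw [hf, MonoidalClosed.curry_natural_left]

theorem sem_succ_aux {X Y P Q : C} {m : X ⟶ Y} {f : Y ⟶ Q} {f' : X ⟶ Q} (hf : f' = m ≫ f) :
    CartesianMonoidalCategory.snd P X ≫ f' =
      P ◁ m ≫ CartesianMonoidalCategory.snd P Y ≫ f := by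
  rw [hf, whiskerLeft_snd_assoc]

theorem sem_beta_aux {X P Q : C} (f : P ⊗ X ⟶ Q) (g : X ⟶ P) :
    CartesianMonoidalCategory.lift g (MonoidalClosed.curry f) ≫ (ihom.ev P).app Q =
      CartesianMonoidalCategory.lift g (𝟙 X) ≫ f := by
  have h : CartesianMonoidalCategory.lift g (MonoidalClosed.curry f) =
      CartesianMonoidalCategory.lift g (𝟙 X) ≫ (P ◁ MonoidalClosed.curry f) := by simp
  rw [h, Category.assoc, ← MonoidalClosed.uncurry_eq, MonoidalClosed.uncurry_curry]

theorem sem_eta_aux {X P Q : C} (f : X ⟶ (ihom P).obj Q) :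
    MonoidalClosed.curry (CartesianMonoidalCategory.lift (CartesianMonoidalCategory.fst P X)
      (CartesianMonoidalCategory.snd P X ≫ f) ≫ (ihom.ev P).app Q) = f := by
  have h : CartesianMonoidalCategory.lift (CartesianMonoidalCategory.fst P X)
      (CartesianMonoidalCategory.snd P X ≫ f) = P ◁ f := by
    ext <;> simp
  rw [h, ← MonoidalClosed.uncurry_eq, MonoidalClosed.curry_uncurry]

theorem sem_eta_pair_aux {X P Q : C} (f : X ⟶ P ⊗ Q) :
    CartesianMonoidalCategory.lift (f ≫ CartesianMonoidalCategory.fst P Q)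
      (f ≫ CartesianMonoidalCategory.snd P Q) = f := by
  ext <;> simp

theorem Term.sem_rename (c : C) {Γ : Ctx} {A : Ty} (t : Term Γ A) :
    ∀ {Δ : Ctx} (ρ : Ren Γ Δ) (m : Ctx.sem c Δ ⟶ Ctx.sem c Γ),
      (∀ (A' : Ty) (x : Var Γ A'), (ρ _ x).sem c = m ≫ x.sem c) →
      (t.rename ρ).sem c = m ≫ t.sem c := by
  induction t with
  | var x => intro Δ ρ m h; exact h _ x
  | @lam Γ A B t ih =>
    intro Δ ρ m h
    refine sem_lam_aux (ih (ρ.lift _) (Ty.sem c A ◁ m) ?_)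
    intro A' x
    cases x with
    | zero => exact (whiskerLeft_fst _ _).symm
    | succ x => exact sem_succ_aux (h _ x)
  | app t s iht ihs =>
    intro Δ ρ m h; exact sem_app_aux (iht ρ m h) (ihs ρ m h)
  | pair t s iht ihs =>
    intro Δ ρ m h; exact sem_pair_aux (iht ρ m h) (ihs ρ m h)
  | fst t ih => intro Δ ρ m h; exact sem_comp_aux (ih ρ m h) _
  | snd t ih => intro Δ ρ m h; exact sem_comp_aux (ih ρ m h) _
  | star => intro Δ ρ m h; exact toUnit_unique _ _

theorem Term.sem_weaken (c : C) {Γ : Ctx} {A : Ty} (B : Ty) (t : Term Γ A) :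
    (t.weaken B).sem c = CartesianMonoidalCategory.snd (Ty.sem c B) (Ctx.sem c Γ) ≫ t.sem c :=
  Term.sem_rename c t _ _ (fun _ _ => rfl)

theorem Term.sem_subst (c : C) {Γ : Ctx} {A : Ty} (t : Term Γ A) :
    ∀ {Δ : Ctx} (σ : Sub Γ Δ) (m : Ctx.sem c Δ ⟶ Ctx.sem c Γ),
      (∀ (A' : Ty) (x : Var Γ A'), (σ _ x).sem c = m ≫ x.sem c) →
      (t.subst σ).sem c = m ≫ t.sem c := by
  induction t with
  | var x => intro Δ σ m h; exact h _ x
  | @lam Γ A B t ih =>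
    intro Δ σ m h
    refine sem_lam_aux (ih (σ.lift _) (Ty.sem c A ◁ m) ?_)
    intro A' x
    cases x with
    | zero => exact (whiskerLeft_fst _ _).symm
    | succ x => exact (Term.sem_weaken c A _).trans (sem_succ_aux (h _ x))
  | app t s iht ihs =>
    intro Δ σ m h; exact sem_app_aux (iht σ m h) (ihs σ m h)
  | pair t s iht ihs =>
    intro Δ σ m h; exact sem_pair_aux (iht σ m h) (ihs σ m h)
  | fst t ih => intro Δ σ m h; exact sem_comp_aux (ih σ m h) _
  | snd t ih => intro Δ σ m h; exact sem_comp_aux (ih σ m h) _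
  | star => intro Δ σ m h; exact toUnit_unique _ _

theorem Conv.sem_eq (c : C) {Γ : Ctx} {A : Ty} {t s : Term Γ A} (h : Conv t s) :
    t.sem c = s.sem c := by
  induction h with
  | refl t => rfl
  | symm _ ih => exact ih.symm
  | trans _ _ ih₁ ih₂ => exact ih₁.trans ih₂
  | lam _ ih => exact congrArg (fun f => MonoidalClosed.curry f) ih
  | app _ _ ih₁ ih₂ => simp [Term.sem, ih₁, ih₂]
  | pair _ _ ih₁ ih₂ => exact congrArg₂ CartesianMonoidalCategory.lift ih₁ ih₂
  | fst _ ih => simp [Term.sem, ih]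
  | snd _ ih => simp [Term.sem, ih]
  | @beta Γ A B t s =>
    refine (sem_beta_aux _ _).trans (Term.sem_subst c t (Sub.single s) _ ?_).symm
    intro A' x
    cases x with
    | zero => exact (lift_fst _ _).symm
    | succ x => exact ((lift_snd_assoc _ _ _).trans (Category.id_comp _)).symm
  | beta_fst t s => exact lift_fst _ _
  | beta_snd t s => exact lift_snd _ _
  | @eta Γ A B t =>
    refine Eq.trans ?_ (sem_eta_aux (t.sem c))
    simp only [Term.sem, Term.sem_weaken, Var.sem]
    rfl
  | eta_pair t => exact sem_eta_pair_aux _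
  | eta_unit t => exact toUnit_unique _ _

/-- The semantic bracket `⟦-⟧_c`, from closed terms modulo `βη`-conversion to points. -/
def Tm.sem (c : C) {A : Ty} (t : Tm A) : 𝟙_ C ⟶ Ty.sem c A :=
  Quotient.liftOn t (fun t => Term.sem c t) (fun _ _ h => Conv.sem_eq c h)

/-! ### Semantic recognition -/

/-- The language of those closed terms of type `A` whose interpretation at `c` belongs to `F`. -/
def semLang (c : C) {A : Ty} (F : Set (𝟙_ C ⟶ Ty.sem c A)) : Set (Tm A) :=
  {t | t.sem c ∈ F}

/-- The set of the languages of λ-terms of type `A` recognized by the object `c`. -/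
def Rec (c : C) (A : Ty) : Set (Set (Tm A)) :=
  {L | ∃ F : Set (𝟙_ C ⟶ Ty.sem c A), L = semLang c F}

end Semantics

/-- The languages of λ-terms recognized by the cartesian closed category `C`. -/
def IsRecognizedBy (C : Type u) [Category.{v} C] [CartesianMonoidalCategory C] [MonoidalClosed C]
    {A : Ty} (L : Set (Tm A)) : Prop :=
  ∃ c : C, L ∈ Rec c A

/-- A category is non-degenerate if it has two distinct parallel morphisms. -/
def NonDegenerate (C : Type u) [Category.{v} C] : Prop :=
  ∃ (c' c : C) (f g : c' ⟶ c), f ≠ g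

end STLC

/-!
Let `c` be the codomain of two distinct parallel morphisms `f` and `g`.

* Every closed term of type `Bool = o × o → o` is convertible to `true` or `false`
  (`eq_tmTrue_or_eq_tmFalse`). No normalization theorem is needed for this: it follows from the
  fundamental lemma (`Reducible.subst`) of a unary logical relation on the terms in the one
  context `[o × o]`, which at the base type holds of the terms convertible to one of the two
  projections of the variable. Since that context never has to be extended, the relation is not
  indexed by worlds.
* The interpretations of `true` and `false` at `c` differ (`sem_tmTrue_ne_sem_tmFalse`): were they
  equal, the two projections `c ⊗ c ⟶ c` would be, hence also `f` and `g`. With the previous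
  point, a closed term of type `Bool` is convertible to `true` as soon as the two have the same
  interpretation at `c`.
* The interpretation of `t[B]` at `c` is that of `t` at `⟦B⟧_c`, up to the equality of objects
  `⟦A[B]⟧_c = ⟦A⟧_{⟦B⟧_c}` (`Ty.sem_castTy`, `Term.sem_cast_heq`).

Hence whether `r t[B]` is convertible to `true` depends only on the interpretation of `t` at
`⟦B⟧_c`, so the language is recognized by the set of the interpretations of its members.
-/

namespace STLC

/-! ### Substitution calculus -/

/-- Extension of a simultaneous substitution by a term for a new variable. -/
def Sub.cons {Γ Δ : Ctx} {B : Ty} (s : Term Δ B) (σ : Sub Γ Δ) : Sub (B :: Γ) Δ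
  | _, .zero => s
  | _, .succ x => σ _ x

theorem Term.subst_congr {Γ : Ctx} {A : Ty} (t : Term Γ A) {Δ : Ctx} {σ τ : Sub Γ Δ}
    (h : ∀ (A : Ty) (x : Var Γ A), σ A x = τ A x) : t.subst σ = t.subst τ := by
  rw [show σ = τ from funext fun A => funext fun x => h A x]

theorem Term.subst_var {Γ : Ctx} {A : Ty} (t : Term Γ A) :
    t.subst (fun _ x => .var x) = t := by
  induction t with
  | var x => rfl
  | lam t ih =>
    refine congrArg Term.lam ((t.subst_congr ?_).trans ih)
    intro A x
    cases x <;> rfl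
  | app t s iht ihs => exact congrArg₂ Term.app iht ihs
  | pair t s iht ihs => exact congrArg₂ Term.pair iht ihs
  | fst t ih => exact congrArg Term.fst ih
  | snd t ih => exact congrArg Term.snd ih
  | star => rfl

theorem Term.rename_eq_subst {Γ : Ctx} {A : Ty} (t : Term Γ A) :
    ∀ {Δ : Ctx} (ρ : Ren Γ Δ), t.rename ρ = t.subst (fun _ x => .var (ρ _ x)) := by
  induction t with
  | var x => intro Δ ρ; rfl
  | lam t ih =>
    intro Δ ρ
    refine congrArg Term.lam ((ih _).trans (t.subst_congr ?_))
    intro A x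
    cases x <;> rfl
  | app t s iht ihs => intro Δ ρ; exact congrArg₂ Term.app (iht ρ) (ihs ρ)
  | pair t s iht ihs => intro Δ ρ; exact congrArg₂ Term.pair (iht ρ) (ihs ρ)
  | fst t ih => intro Δ ρ; exact congrArg Term.fst (ih ρ)
  | snd t ih => intro Δ ρ; exact congrArg Term.snd (ih ρ)
  | star => intro Δ ρ; rfl

theorem Term.subst_rename {Γ : Ctx} {A : Ty} (t : Term Γ A) :
    ∀ {Δ Θ : Ctx} (ρ : Ren Γ Δ) (σ : Sub Δ Θ),
      (t.rename ρ).subst σ = t.subst (fun _ x => σ _ (ρ _ x)) := by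
  induction t with
  | var x => intro Δ Θ ρ σ; rfl
  | lam t ih =>
    intro Δ Θ ρ σ
    refine congrArg Term.lam ((ih _ _).trans (t.subst_congr ?_))
    intro A x
    cases x <;> rfl
  | app t s iht ihs => intro Δ Θ ρ σ; exact congrArg₂ Term.app (iht ρ σ) (ihs ρ σ)
  | pair t s iht ihs => intro Δ Θ ρ σ; exact congrArg₂ Term.pair (iht ρ σ) (ihs ρ σ)
  | fst t ih => intro Δ Θ ρ σ; exact congrArg Term.fst (ih ρ σ)
  | snd t ih => intro Δ Θ ρ σ; exact congrArg Term.snd (ih ρ σ)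
  | star => intro Δ Θ ρ σ; rfl

theorem Term.weaken_subst_single {Γ : Ctx} {A B : Ty} (t : Term Γ A) (s : Term Γ B) :
    (t.weaken B).subst (Sub.single s) = t :=
  (t.subst_rename _ _).trans t.subst_var

theorem Term.rename_rename {Γ Δ Θ : Ctx} {A : Ty} (t : Term Γ A) (ρ : Ren Γ Δ) (ρ' : Ren Δ Θ) :
    (t.rename ρ).rename ρ' = t.rename (fun _ x => ρ' _ (ρ _ x)) := by
  rw [Term.rename_eq_subst _ ρ', Term.subst_rename, Term.rename_eq_subst]

theorem Term.rename_subst {Γ : Ctx} {A : Ty} (t : Term Γ A) :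
    ∀ {Δ Θ : Ctx} (σ : Sub Γ Δ) (ρ : Ren Δ Θ),
      (t.subst σ).rename ρ = t.subst (fun _ x => (σ _ x).rename ρ) := by
  induction t with
  | var x => intro Δ Θ σ ρ; rfl
  | lam t ih =>
    intro Δ Θ σ ρ
    refine congrArg Term.lam ((ih _ _).trans (t.subst_congr ?_))
    intro A x
    cases x with
    | zero => rfl
    | succ x => exact (Term.rename_rename _ _ _).trans ((σ _ x).rename_rename ρ _).symm
  | app t s iht ihs => intro Δ Θ σ ρ; exact congrArg₂ Term.app (iht σ ρ) (ihs σ ρ)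
  | pair t s iht ihs => intro Δ Θ σ ρ; exact congrArg₂ Term.pair (iht σ ρ) (ihs σ ρ)
  | fst t ih => intro Δ Θ σ ρ; exact congrArg Term.fst (ih σ ρ)
  | snd t ih => intro Δ Θ σ ρ; exact congrArg Term.snd (ih σ ρ)
  | star => intro Δ Θ σ ρ; rfl

theorem Term.subst_subst {Γ : Ctx} {A : Ty} (t : Term Γ A) :
    ∀ {Δ Θ : Ctx} (σ : Sub Γ Δ) (τ : Sub Δ Θ),
      (t.subst σ).subst τ = t.subst (fun _ x => (σ _ x).subst τ) := by
  induction t with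
  | var x => intro Δ Θ σ τ; rfl
  | lam t ih =>
    intro Δ Θ σ τ
    refine congrArg Term.lam ((ih _ _).trans (t.subst_congr ?_))
    intro A x
    cases x with
    | zero => rfl
    | succ x => exact (Term.subst_rename _ _ _).trans (Term.rename_subst _ _ _).symm
  | app t s iht ihs => intro Δ Θ σ τ; exact congrArg₂ Term.app (iht σ τ) (ihs σ τ)
  | pair t s iht ihs => intro Δ Θ σ τ; exact congrArg₂ Term.pair (iht σ τ) (ihs σ τ)
  | fst t ih => intro Δ Θ σ τ; exact congrArg Term.fst (ih σ τ)
  | snd t ih => intro Δ Θ σ τ; exact congrArg Term.snd (ih σ τ)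
  | star => intro Δ Θ σ τ; rfl

theorem Term.subst_lift_single {Γ Δ : Ctx} {A B : Ty} (t : Term (B :: Γ) A) (σ : Sub Γ Δ)
    (s : Term Δ B) : (t.subst (σ.lift B)).subst (Sub.single s) = t.subst (Sub.cons s σ) := by
  refine (t.subst_subst _ _).trans (t.subst_congr ?_)
  intro A x
  cases x with
  | zero => rfl
  | succ x => exact Term.weaken_subst_single _ _

/-! ### Closed terms of Boolean type -/

/-- The context consisting of one variable of type `o × o`. -/
abbrev boolCtx : Ctx := [.prod .base .base]

/-- The unary logical relation on the terms in the context `boolCtx` that holds, at the base type,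
of the terms convertible to one of the two projections of the variable. -/
def Reducible : ∀ A : Ty, Term boolCtx A → Prop
  | .base, t => Conv t (.fst (.var .zero)) ∨ Conv t (.snd (.var .zero))
  | .arr A B, t => ∀ s : Term boolCtx A, Reducible A s → Reducible B (.app t s)
  | .prod A B, t => Reducible A (.fst t) ∧ Reducible B (.snd t)
  | .unit, _ => True

theorem Reducible.conv {A : Ty} {t t' : Term boolCtx A} (h : Conv t t') (ht : Reducible A t) :
    Reducible A t' := by
  induction A with
  | base => exact ht.imp h.symm.trans h.symm.trans
  | arr A B _ ihB => exact fun s hs => ihB (.app h (.refl s)) (ht s hs)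
  | prod A B ihA ihB => exact ⟨ihA (.fst h) ht.1, ihB (.snd h) ht.2⟩
  | unit => trivial

/-- The fundamental lemma of the logical relation: every instance of a term under a substitution by
reducible terms is reducible. -/
theorem Reducible.subst {Γ : Ctx} {A : Ty} (t : Term Γ A) :
    ∀ σ : Sub Γ boolCtx, (∀ (A' : Ty) (x : Var Γ A'), Reducible A' (σ _ x)) →
      Reducible A (t.subst σ) := by
  induction t with
  | var x => intro σ h; exact h _ x
  | lam t ih =>
    intro σ h s hs
    refine Reducible.conv (Conv.beta _ _).symm ?_
    rw [Term.subst_lift_single]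
    refine ih _ ?_
    intro A' x
    cases x with
    | zero => exact hs
    | succ x => exact h _ x
  | app t s iht ihs => intro σ h; exact iht σ h _ (ihs σ h)
  | pair t s iht ihs =>
    intro σ h
    exact ⟨(iht σ h).conv (Conv.beta_fst _ _).symm, (ihs σ h).conv (Conv.beta_snd _ _).symm⟩
  | fst t ih => intro σ h; exact (ih σ h).1
  | snd t ih => intro σ h; exact (ih σ h).2
  | star => intro σ h; trivial

theorem eq_tmTrue_or_eq_tmFalse (b : Tm boolTy) : b = tmTrue ∨ b = tmFalse := by
  induction b using Quotient.inductionOn with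
  | h t =>
    have hw : Reducible boolTy (t.weaken (.prod .base .base)) := by
      -- As `t` is closed, its weakening is its instance under the empty substitution.
      rw [Term.weaken, Term.rename_eq_subst]
      exact Reducible.subst t _ (fun _ x => nomatch x)
    have hx : Reducible (.prod .base .base) (.var .zero) := ⟨.inl (.refl _), .inr (.refl _)⟩
    -- The relation at `t x`, for the variable `x`, is the claim for the body of the `η`-expansion
    -- of `t`.
    exact (hw _ hx).imp (fun h => Quotient.sound ((Conv.eta t).symm.trans (.lam h)))
      (fun h => Quotient.sound ((Conv.eta t).symm.trans (.lam h)))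

/-! ### Operations of a cartesian closed category along equalities of objects -/

theorem comp_heq {C : Type u} [Category.{v} C] {X X' Y Y' Z Z' : C}
    (hX : X = X') (hY : Y = Y') (hZ : Z = Z') {f : X ⟶ Y} {f' : X' ⟶ Y'} {g : Y ⟶ Z} {g' : Y' ⟶ Z'} (hf : f ≍ f') (hg : g ≍ g') :
    f ≫ g ≍ f' ≫ g' := by
  subst hX hY hZ hf hg; rfl

section Cartesian

variable {C : Type u} [Category.{v} C] [CartesianMonoidalCategory C]

theorem fst_heq {X X' Y Y' : C} (hX : X = X') (hY : Y = Y') :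
    CartesianMonoidalCategory.fst X Y ≍ CartesianMonoidalCategory.fst X' Y' := by
  subst hX hY; rfl

theorem snd_heq {X X' Y Y' : C} (hX : X = X') (hY : Y = Y') :
    CartesianMonoidalCategory.snd X Y ≍ CartesianMonoidalCategory.snd X' Y' := by
  subst hX hY; rfl

theorem lift_heq {X X' Y Y' Z Z' : C} (hX : X = X') (hY : Y = Y') (hZ : Z = Z')
    {f : X ⟶ Y} {f' : X' ⟶ Y'} {g : X ⟶ Z} {g' : X' ⟶ Z'} (hf : f ≍ f') (hg : g ≍ g') :
    CartesianMonoidalCategory.lift f g ≍ CartesianMonoidalCategory.lift f' g' := by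
  subst hX hY hZ hf hg; rfl

theorem toUnit_heq {X X' : C} (hX : X = X') : toUnit X ≍ toUnit X' := by
  subst hX; rfl

end Cartesian

section Closed

variable {C : Type u} [Category.{v} C] [CartesianMonoidalCategory C] [MonoidalClosed C]

theorem curry_heq {X X' Y Y' Z Z' : C} (hX : X = X') (hY : Y = Y') (hZ : Z = Z')
    {f : Y ⊗ X ⟶ Z} {f' : Y' ⊗ X' ⟶ Z'} (hf : f ≍ f') :
    MonoidalClosed.curry f ≍ MonoidalClosed.curry f' := by
  subst hX hY hZ hf; rfl

theorem ev_heq {X X' Y Y' : C} (hX : X = X') (hY : Y = Y') :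
    (ihom.ev X).app Y ≍ (ihom.ev X').app Y' := by
  subst hX hY; rfl

end Closed

/-! ### Semantics of Booleans, of casts and of recognized languages -/

section Semantics

variable {C : Type u} [Category.{v} C] [CartesianMonoidalCategory C] [MonoidalClosed C]

theorem sem_tmTrue_ne_sem_tmFalse {c' c : C} {f g : c' ⟶ c} (hfg : f ≠ g) :
    tmTrue.sem c ≠ tmFalse.sem c := by
  intro h
  have h' : CartesianMonoidalCategory.fst (c ⊗ c) (𝟙_ C) ≫ CartesianMonoidalCategory.fst c c =
      CartesianMonoidalCategory.fst (c ⊗ c) (𝟙_ C) ≫ CartesianMonoidalCategory.snd c c :=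
    MonoidalClosed.curry_injective h
  apply hfg
  -- Precomposition with `⟨⟨f, g⟩, !⟩` turns the two projections into `f` and `g`.
  simpa using congrArg
    (CartesianMonoidalCategory.lift (CartesianMonoidalCategory.lift f g) (toUnit c') ≫ ·) h'

theorem eq_tmTrue_of_sem_eq {c' c : C} {f g : c' ⟶ c} (hfg : f ≠ g) {b : Tm boolTy}
    (h : b.sem c = tmTrue.sem c) : b = tmTrue := by
  refine (eq_tmTrue_or_eq_tmFalse b).resolve_right ?_
  rintro rfl
  exact sem_tmTrue_ne_sem_tmFalse hfg h.symm

theorem Ty.sem_castTy (c : C) (B A : Ty) :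
    Ty.sem c (castTy B A) = Ty.sem (Ty.sem c B) A := by
  induction A with
  | base => rfl
  | arr A₁ A₂ ih₁ ih₂ => exact congrArg₂ (fun X Y : C => (ihom X).obj Y) ih₁ ih₂
  | prod A₁ A₂ ih₁ ih₂ => exact congrArg₂ (fun X Y : C => X ⊗ Y) ih₁ ih₂
  | unit => rfl

theorem Ctx.sem_map_castTy (c : C) (B : Ty) (Γ : Ctx) :
    Ctx.sem c (Γ.map (castTy B)) = Ctx.sem (Ty.sem c B) Γ := by
  induction Γ with
  | nil => rfl
  | cons A Γ ih => exact congrArg₂ (fun X Y : C => X ⊗ Y) (Ty.sem_castTy c B A) ih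

theorem Var.sem_cast_heq (c : C) (B : Ty) {Γ : Ctx} {A : Ty} (x : Var Γ A) :
    (x.cast B).sem c ≍ x.sem (Ty.sem c B) := by
  induction x with
  | @zero Γ A => exact fst_heq (Ty.sem_castTy c B A) (Ctx.sem_map_castTy c B Γ)
  | @succ Γ A A' x ih =>
    exact comp_heq (Ctx.sem_map_castTy c B (A' :: Γ)) (Ctx.sem_map_castTy c B Γ)
      (Ty.sem_castTy c B A) (snd_heq (Ty.sem_castTy c B A') (Ctx.sem_map_castTy c B Γ)) ih

/-- Interpreting `t[B]` at `c` amounts to interpreting `t` at `⟦B⟧_c`. The equality is heterogeneous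
because the hom-sets are identified only by the recursive equalities `Ctx.sem_map_castTy` and
`Ty.sem_castTy`. -/
theorem Term.sem_cast_heq (c : C) (B : Ty) {Γ : Ctx} {A : Ty} (t : Term Γ A) :
    (t.cast B).sem c ≍ t.sem (Ty.sem c B) := by
  have hΓ := Ctx.sem_map_castTy c B
  have hA := Ty.sem_castTy c B
  induction t with
  | var x => exact x.sem_cast_heq c B
  | lam t ih => exact curry_heq (hΓ _) (hA _) (hA _) ih
  | @app Γ A₁ A₂ t s iht ihs =>
    exact comp_heq (hΓ Γ) (congrArg₂ (fun X Y : C => X ⊗ Y) (hA A₁) (hA (.arr A₁ A₂))) (hA A₂)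
      (lift_heq (hΓ Γ) (hA A₁) (hA (.arr A₁ A₂)) ihs iht) (ev_heq (hA A₁) (hA A₂))
  | pair t s iht ihs => exact lift_heq (hΓ _) (hA _) (hA _) iht ihs
  | @fst Γ A₁ A₂ t ih =>
    exact comp_heq (hΓ Γ) (hA (.prod A₁ A₂)) (hA A₁) ih (fst_heq (hA A₁) (hA A₂))
  | @snd Γ A₁ A₂ t ih =>
    exact comp_heq (hΓ Γ) (hA (.prod A₁ A₂)) (hA A₂) ih (snd_heq (hA A₁) (hA A₂))
  | star => exact toUnit_heq (hΓ _)

theorem Tm.sem_cast_heq (c : C) (B : Ty) {A : Ty} (t : Tm A) :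
    (t.cast B).sem c ≍ t.sem (Ty.sem c B) := by
  induction t using Quotient.inductionOn with
  | h t => exact t.sem_cast_heq c B

theorem Tm.sem_app (c : C) {A B : Ty} (t : Tm (.arr A B)) (s : Tm A) :
    (t.app s).sem c =
      CartesianMonoidalCategory.lift (s.sem c) (t.sem c) ≫ (ihom.ev _).app _ := by
  induction t, s using Quotient.inductionOn₂ with
  | h t s => rfl

/-- If the semantics at `c` separates `true` and `false`, membership in `hkLang r` is determined
by the interpretation at `⟦B⟧_c`; separation is ensured by the distinct morphisms into `c`. -/
theorem mem_hkLang_of_sem_eq {c' c : C} {f g : c' ⟶ c} (hfg : f ≠ g) {A B : Ty}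
    {r : Tm (.arr (castTy B A) boolTy)} {s t : Tm A} (hs : s ∈ hkLang r)
    (h : t.sem (Ty.sem c B) = s.sem (Ty.sem c B)) : t ∈ hkLang r := by
  have hst : (t.cast B).sem c = (s.cast B).sem c :=
    eq_of_heq ((t.sem_cast_heq c B).trans ((heq_of_eq h).trans (s.sem_cast_heq c B).symm))
  refine eq_tmTrue_of_sem_eq hfg ?_
  rw [Tm.sem_app, hst, ← Tm.sem_app]
  exact congrArg (Tm.sem c) hs

theorem hkLang_mem_rec {c' c : C} {f g : c' ⟶ c} (hfg : f ≠ g) {A B : Ty}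
    (r : Tm (.arr (castTy B A) boolTy)) : hkLang r ∈ Rec (Ty.sem c B) A := by
  refine ⟨Tm.sem (Ty.sem c B) '' hkLang r, Set.ext fun t => ⟨fun ht => ⟨t, ht, rfl⟩, ?_⟩⟩
  rintro ⟨s, hs, hst⟩
  exact mem_hkLang_of_sem_eq hfg hs hst.symm

end Semantics

end STLC

theorem mainTheorem2 {C : Type u} [Category.{v} C] [CartesianMonoidalCategory C]
    [MonoidalClosed C] (hC : STLC.NonDegenerate C) :
    (∀ (A : STLC.Ty) (L : Set (STLC.Tm A)), STLC.IsHKReg L → STLC.IsRecognizedBy C L) ∧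
    (∀ (c' c : C) (f g : c' ⟶ c), f ≠ g →
      ∀ (A B : STLC.Ty) (r : STLC.Tm (.arr (STLC.castTy B A) STLC.boolTy)),
        STLC.hkLang r ∈ STLC.Rec (STLC.Ty.sem c B) A) := by
  refine ⟨?_, fun c' c f g hfg A B r => STLC.hkLang_mem_rec hfg r⟩
  rintro A L ⟨B, r, rfl⟩
  obtain ⟨c', c, f, g, hfg⟩ := hC
  exact ⟨STLC.Ty.sem c B, STLC.hkLang_mem_rec hfg r⟩
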